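/- There is a universal constant $C>0$ such that the following holds. Let $n\in\mathbb{N}$, let $H$ be a real symmetric $n\times n$ matrix, let $(\psi_k)_{1\le k\le n}$ be an orthonormal basis of $\mathbb{R}^n$ consisting of eigenvectors of $H$, with $H\psi_k=\lambda_k\psi_k$, and let $I\subset\mathbb{R}$ be any subset such that $N(I):=\#\{k:\lambda_k\in I\}\geq 1$ (so $N(I)$ is the number of eigenvalues of $H$ in $I$, counted with multiplicity). Let $E_I=\operatorname{span}\{\psi_k:\lambda_k\in I\}$, let $\mathbb{S}_I$ be the Euclidean unit sphere of $E_I$, and let $u$ be a random vector distributed according to the uniform probability measure $\mathbb{P}_I$ on $\mathbb{S}_I$. Write $\|u\|_{L^q}=\bigl(\sum_{i=1}^n|u_i|^q\bigr)^{1/q}$ for $q<\infty$ and $\|u\|_{L^\infty}=\max_{1\le i\le n}|u_i|$. Then: (i) for every real $q\in[2,+\infty)$ and every $\Lambda\geq 1$, $$\mathbb{P}_I\left(\|u\|_{L^q}\geq C\Lambda\sqrt{q}\,N(I)^{\frac1q-\frac12}\right)\leq 4\exp\left(-\tfrac18 C^2\Lambda^2 q\,N(I)^{\frac2q}\right);$$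 (ii) for every $\Lambda\geq 1$, with $C'=Ce$, $$\mathbb{P}_I\left(\|u\|_{L^\infty}\geq C'\Lambda\left(\frac{\log N(I)}{N(I)}\right)^{\frac12}\right)\leq 4N(I)^{-\frac18 C'^2\Lambda^2}.$$ -/

import Mathlib

open MeasureTheory
open scoped ENNReal Matrix

/-- The uniform probability measure on the unit sphere of a finite-dimensional real inner product
space `E` (of positive dimension): the surface (cone) measure induced on the sphere by Lebesgue
measure on `E`, divided by its total mass. -/
noncomputable def uniformSphere (E : Type*) [NormedAddCommGroup E] [InnerProductSpace ℝ E]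
    [FiniteDimensional ℝ E] [MeasurableSpace E] [BorelSpace E] :
    Measure (Metric.sphere (0 : E) 1) :=
  ((volume : Measure E).toSphere Set.univ)⁻¹ • (volume : Measure E).toSphere

/-- The `L^q` norm on `ℝⁿ`, `q ∈ (0, ∞]`, for the counting measure on coordinates:
`(∑ i, |x i| ^ q) ^ (1 / q)` for finite `q`, and `max i, |x i|` for `q = ∞`. -/
noncomputable def lqNorm {n : ℕ} (q : ℝ≥0∞) (x : EuclideanSpace ℝ (Fin n)) : ℝ :=
  ‖(WithLp.toLp q (WithLp.ofLp x) : PiLp q (fun _ : Fin n => ℝ))‖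

/-- `ψ` is an orthonormal basis of `ℝⁿ` made of eigenvectors of `H`, the eigenvalue of `ψ k`
being `lam k`. -/
def IsEigenbasis {n : ℕ} (H : Matrix (Fin n) (Fin n) ℝ)
    (ψ : OrthonormalBasis (Fin n) ℝ (EuclideanSpace ℝ (Fin n))) (lam : Fin n → ℝ) : Prop :=
  ∀ k, H *ᵥ (ψ k).ofLp = lam k • (ψ k).ofLp

/-- `N(I)`: the number of indices `k` with `lam k ∈ I`, that is the number of eigenvalues in `I`
counted with multiplicity. -/
noncomputable def eigenCount {n : ℕ} (lam : Fin n → ℝ) (I : Set ℝ) : ℕ :=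
  {k | lam k ∈ I}.ncard

/-- `E_I`: the linear span of the `ψ k` with `lam k ∈ I`. -/
def spectralSpan {n : ℕ} (ψ : OrthonormalBasis (Fin n) ℝ (EuclideanSpace ℝ (Fin n)))
    (lam : Fin n → ℝ) (I : Set ℝ) : Submodule ℝ (EuclideanSpace ℝ (Fin n)) :=
  Submodule.span ℝ (ψ '' {k | lam k ∈ I})

/-! The estimates hold for any nonzero subspace `V` of Euclidean space and involve `V` only through
its dimension `N`; the spectral span has dimension `N(I)`. A uniform unit vector is the direction of
a standard Gaussian vector of `V`, independent of its length, which is at least `17/20 √N` with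
probability at least `1/4` once `N ≥ 256`. So the spherical tail at level `t` is at most 4 times the
Gaussian tail at level `17/20 t √N` (`uniformSphere_mul_stdGaussian_le`,
`one_fourth_le_stdGaussian_norm_ge`); this is the factor 4 in the statement.

For the Gaussian tail, the `L^q` norm with `q ≥ 2` is at most the Euclidean norm, so Maurey–Pisier
concentration applies (`stdGaussian_real_norm_map_ge_le`). Its mean is at most `M = √q N^(1/q)`,
because the squared norms of the coordinate forms on `V` sum to `N`
(`integral_lqNorm_stdGaussian_le`). The threshold becomes `17/20 a M`, where `a = CΛ`, and `C = 16`
makes the exponent at least `a² M² / 8`. If `t > 1` the event is empty; otherwise `a M ≤ √N`, which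
forces `N ≥ 256`.

The maximum norm is at most the `L^q` norm with `q = log N`, for which `N^(1/q) = e`; values of `N`
with `log N < 2` are handled directly. -/

/-! ### Gaussian concentration for seminorms. -/

open ProbabilityTheory in
/-- The moment generating function of a linear form under the standard Gaussian measure. -/
lemma mgf_strongDual_stdGaussian {E : Type*} [NormedAddCommGroup E] [InnerProductSpace ℝ E]
    [FiniteDimensional ℝ E] [MeasurableSpace E] [BorelSpace E] (L : StrongDual ℝ E) (t : ℝ) :
    mgf L (stdGaussian E) t = Real.exp (‖L‖ ^ 2 * t ^ 2 / 2) := by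
  have h := IsGaussian.map_eq_gaussianReal (μ := stdGaussian E) L
  rw [mgf_gaussianReal h, variance_dual_stdGaussian, integral_strongDual_stdGaussian]
  simp

-- Fernique's theorem gives a finite moment of `exp (C ‖x‖²)`, and completing the square bounds `a
-- ‖x‖` by `C ‖x‖² + a² / (4C)`.
open ProbabilityTheory in
lemma integrable_exp_mul_norm_stdGaussian (E : Type*) [NormedAddCommGroup E]
    [InnerProductSpace ℝ E] [FiniteDimensional ℝ E] [MeasurableSpace E] [BorelSpace E] (a : ℝ) :
    Integrable (fun x : E ↦ Real.exp (a * ‖x‖)) (stdGaussian E) := by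
  obtain ⟨C, hC, h⟩ := IsGaussian.exists_integrable_exp_sq (stdGaussian E)
  refine (h.const_mul (Real.exp (a ^ 2 / (4 * C)))).mono' (by fun_prop) (ae_of_all _ fun x ↦ ?_)
  rw [Real.norm_of_nonneg (Real.exp_nonneg _), ← Real.exp_add, Real.exp_le_exp]
  have : a ^ 2 / (4 * C) + C * ‖x‖ ^ 2 - a * ‖x‖ = (a - 2 * C * ‖x‖) ^ 2 / (4 * C) := by
    field_simp
    ring
  have h2 : 0 ≤ (a - 2 * C * ‖x‖) ^ 2 / (4 * C) := by positivity
  linarith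

open ProbabilityTheory in
lemma integrable_exp_mul_norm_map_stdGaussian {E W : Type*} [NormedAddCommGroup E]
    [InnerProductSpace ℝ E] [FiniteDimensional ℝ E] [MeasurableSpace E] [BorelSpace E]
    [NormedAddCommGroup W] [NormedSpace ℝ W] (T : E →L[ℝ] W) (a : ℝ) :
    Integrable (fun x : E ↦ Real.exp (a * ‖T x‖)) (stdGaussian E) := by
  refine (integrable_exp_mul_norm_stdGaussian E (|a| * ‖T‖)).mono'
    (Continuous.aestronglyMeasurable (by fun_prop)) (ae_of_all _ fun x ↦ ?_)
  rw [Real.norm_of_nonneg (Real.exp_nonneg _), Real.exp_le_exp, mul_assoc]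
  exact mul_le_mul (le_abs_self a) (T.le_opNorm x) (norm_nonneg _) (abs_nonneg _)

open ProbabilityTheory in
/-- One rotation step: the increment of a seminorm along a rotation by `δ` is controlled through
a supporting functional. -/
lemma lintegral_exp_norm_sub_rotate_le {E W : Type*} [NormedAddCommGroup E]
    [InnerProductSpace ℝ E] [FiniteDimensional ℝ E] [MeasurableSpace E] [BorelSpace E]
    [NormedAddCommGroup W] [NormedSpace ℝ W] (T : E →L[ℝ] W) (hT : ‖T‖ ≤ 1)
    {a : ℝ} (ha : 0 ≤ a) (c s : ℝ) :
    ∫⁻ p : E × E, ENNReal.ofReal (Real.exp (a * (‖T p.1‖ - ‖T (c • p.1 - s • p.2)‖)))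
        ∂((stdGaussian E).prod (stdGaussian E))
      ≤ ENNReal.ofReal (Real.exp (a ^ 2 * s ^ 2 / 2) *
          mgf (fun x ↦ ‖T x‖) (stdGaussian E) (a * (1 - c))) := by
  have hm : Measurable fun p : E × E ↦
      ENNReal.ofReal (Real.exp (a * (‖T p.1‖ - ‖T (c • p.1 - s • p.2)‖))) :=
    (Continuous.measurable (by fun_prop)).ennreal_ofReal
  rw [lintegral_prod _ hm.aemeasurable]
  have inner : ∀ x : E, ∫⁻ y, ENNReal.ofReal
      (Real.exp (a * (‖T x‖ - ‖T (c • x - s • y)‖))) ∂(stdGaussian E) ≤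
      ENNReal.ofReal (Real.exp (a ^ 2 * s ^ 2 / 2)) *
        ENNReal.ofReal (Real.exp (a * (1 - c) * ‖T x‖)) := by
    intro x
    -- A functional supporting the norm at `T x` replaces a gradient: `‖T (c x - s y)‖ ≥ c ‖T x‖ - s
    -- g (T y)`. For fixed `x` the last term is a Gaussian linear form in `y`.
    obtain ⟨g, hg, hgx⟩ := exists_dual_vector'' ℝ (T x)
    have hL : ‖g.comp T‖ ≤ 1 := (g.opNorm_comp_le T).trans (mul_le_one₀ hg (norm_nonneg _) hT)
    have hint : Integrable (fun y ↦ Real.exp (a * s * g.comp T y)) (stdGaussian E) := by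
      refine (integrable_exp_mul_norm_stdGaussian E |a * s|).mono'
        (Continuous.aestronglyMeasurable (by fun_prop)) (ae_of_all _ fun y ↦ ?_)
      rw [Real.norm_of_nonneg (Real.exp_nonneg _), Real.exp_le_exp]
      refine (le_abs_self _).trans ?_
      rw [abs_mul]
      gcongr
      have := (g.comp T).le_of_opNorm_le hL y
      rwa [one_mul] at this
    calc ∫⁻ y, ENNReal.ofReal (Real.exp (a * (‖T x‖ - ‖T (c • x - s • y)‖))) ∂(stdGaussian E)
        ≤ ∫⁻ y, ENNReal.ofReal (Real.exp (a * (1 - c) * ‖T x‖)) *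
            ENNReal.ofReal (Real.exp (a * s * g.comp T y)) ∂(stdGaussian E) := by
          refine lintegral_mono fun y ↦ ?_
          rw [← ENNReal.ofReal_mul (Real.exp_nonneg _), ← Real.exp_add]
          gcongr
          have h1 : g (T (c • x - s • y)) ≤ ‖T (c • x - s • y)‖ :=
            (le_abs_self _).trans ((g.le_of_opNorm_le hg _).trans_eq (one_mul _))
          have h2 : g (T (c • x - s • y)) = c * ‖T x‖ - s * g.comp T y := by
            simp only [map_sub, map_smul, smul_eq_mul, hgx, ContinuousLinearMap.comp_apply]
            rfl
          nlinarith
      _ = ENNReal.ofReal (Real.exp (a * (1 - c) * ‖T x‖)) *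
            ENNReal.ofReal (mgf (g.comp T) (stdGaussian E) (a * s)) := by
          rw [lintegral_const_mul _ (Continuous.measurable (by fun_prop)).ennreal_ofReal, mgf,
            ofReal_integral_eq_lintegral_ofReal hint (ae_of_all _ fun _ ↦ Real.exp_nonneg _)]
      _ ≤ _ := by
          rw [mul_comm, mgf_strongDual_stdGaussian]
          refine mul_le_mul_left (ENNReal.ofReal_le_ofReal (Real.exp_le_exp.2 ?_)) _
          rw [mul_pow]
          refine div_le_div_of_nonneg_right ?_ zero_le_two
          exact mul_le_of_le_one_left (by positivity) (pow_le_one₀ (norm_nonneg _) hL)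
  refine (lintegral_mono inner).trans_eq ?_
  rw [lintegral_const_mul _ (Continuous.measurable (by fun_prop)).ennreal_ofReal,
    ENNReal.ofReal_mul (Real.exp_nonneg _), mgf,
    ofReal_integral_eq_lintegral_ofReal (integrable_exp_mul_norm_map_stdGaussian T _)
      (ae_of_all _ fun _ ↦ Real.exp_nonneg _)]

/-- Jensen for the telescoping sum, written as the average of `m` times its increments. -/
lemma exp_mul_sub_le_average {f : ℕ → ℝ} {m : ℕ} (hm : 0 < m) (a : ℝ) :
    Real.exp (a * (f m - f 0)) ≤
      ∑ j ∈ Finset.range m, (m : ℝ)⁻¹ * Real.exp (a * m * (f (j + 1) - f j)) := by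
  have hm' : (m : ℝ) ≠ 0 := by positivity
  have := convexOn_exp.map_sum_le (t := Finset.range m) (w := fun _ ↦ (m : ℝ)⁻¹)
    (p := fun j ↦ a * m * (f (j + 1) - f j)) (fun _ _ ↦ by positivity)
    (by simp [hm']) (fun _ _ ↦ Set.mem_univ _)
  simp only [smul_eq_mul] at this
  refine (congrArg Real.exp ?_).trans_le this
  rw [← Finset.mul_sum, ← Finset.mul_sum, Finset.sum_range_sub]
  field_simp

-- A quarter turn carries `p.1` to `p.2` in `m` rotations by `π / (2m)`. The law of the pair is
-- rotation invariant, so every increment obeys the same one-step bound.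
open ProbabilityTheory in
lemma lintegral_exp_norm_sub_norm_le_of_steps {E W : Type*} [NormedAddCommGroup E]
    [InnerProductSpace ℝ E] [FiniteDimensional ℝ E] [MeasurableSpace E] [BorelSpace E]
    [NormedAddCommGroup W] [NormedSpace ℝ W] (T : E →L[ℝ] W) (hT : ‖T‖ ≤ 1)
    {a : ℝ} (ha : 0 ≤ a) {m : ℕ} (hm : 0 < m) :
    ∫⁻ p : E × E, ENNReal.ofReal (Real.exp (a * (‖T p.2‖ - ‖T p.1‖)))
        ∂((stdGaussian E).prod (stdGaussian E))
      ≤ ENNReal.ofReal (Real.exp ((a * m) ^ 2 * Real.sin (Real.pi / (2 * m)) ^ 2 / 2) *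
          mgf (fun x ↦ ‖T x‖) (stdGaussian E) (a * m * (1 - Real.cos (Real.pi / (2 * m))))) := by
  have hm' : (m : ℝ) ≠ 0 := by positivity
  set δ := Real.pi / (2 * m) with hδ
  set R := Real.exp ((a * m) ^ 2 * Real.sin δ ^ 2 / 2) *
          mgf (fun x ↦ ‖T x‖) (stdGaussian E) (a * m * (1 - Real.cos δ))
  let f : E × E → ℕ → ℝ := fun p j ↦ ‖T (Real.cos (j * δ) • p.1 + Real.sin (j * δ) • p.2)‖
  have hδm : m * δ = Real.pi / 2 := by rw [hδ]; field_simp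
  have f0 : ∀ p, f p 0 = ‖T p.1‖ := by simp [f]
  have fm : ∀ p, f p m = ‖T p.2‖ := by simp [f, hδm]
  have hcont : ∀ j, Continuous fun p ↦ f p j := fun j ↦ by fun_prop
  have step : ∀ j : ℕ, ∫⁻ p : E × E, ENNReal.ofReal (Real.exp (a * m * (f p (j + 1) - f p j)))
        ∂((stdGaussian E).prod (stdGaussian E)) ≤ ENNReal.ofReal R := by
    intro j
    refine le_trans (le_of_eq ?_)
      (lintegral_exp_norm_sub_rotate_le T hT (a := a * m) (by positivity) (Real.cos δ) (Real.sin δ))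
    -- Rotating the pair by `(j + 1) δ` makes its first component the point at time `j + 1`; going
    -- back by `δ` gives the point at time `j`.
    conv_rhs => rw [← IsGaussian.map_rotation_eq_self_of_forall_strongDual_eq_zero
      (μ := stdGaussian E) (fun L ↦ integral_strongDual_stdGaussian L) ((j + 1) * δ)]
    rw [lintegral_map (Continuous.measurable (by fun_prop)).ennreal_ofReal
      (ContinuousLinearMap.continuous _).measurable]
    refine lintegral_congr fun p ↦ ?_
    have h1 : (j : ℝ) * δ = (j + 1) * δ - δ := by ring
    simp only [f, ContinuousLinearMap.rotation_apply]
    rw [h1, Real.cos_sub, Real.sin_sub]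
    push_cast
    congr 6
    module
  calc ∫⁻ p : E × E, ENNReal.ofReal (Real.exp (a * (‖T p.2‖ - ‖T p.1‖)))
        ∂((stdGaussian E).prod (stdGaussian E))
      ≤ ∫⁻ p : E × E, ∑ j ∈ Finset.range m, ENNReal.ofReal (m : ℝ)⁻¹ *
          ENNReal.ofReal (Real.exp (a * m * (f p (j + 1) - f p j)))
        ∂((stdGaussian E).prod (stdGaussian E)) := by
        refine lintegral_mono fun p ↦ ?_
        simp_rw [← ENNReal.ofReal_mul (inv_nonneg.2 (Nat.cast_nonneg m))]
        rw [← ENNReal.ofReal_sum_of_nonneg fun _ _ ↦ by positivity, ← f0, ← fm]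
        exact ENNReal.ofReal_le_ofReal (exp_mul_sub_le_average hm a)
    _ = ∑ j ∈ Finset.range m, ENNReal.ofReal (m : ℝ)⁻¹ *
          ∫⁻ p : E × E, ENNReal.ofReal (Real.exp (a * m * (f p (j + 1) - f p j)))
        ∂((stdGaussian E).prod (stdGaussian E)) := by
        have hme : ∀ j, Measurable fun p : E × E ↦
            ENNReal.ofReal (Real.exp (a * m * (f p (j + 1) - f p j))) := fun j ↦
          ((((hcont (j + 1)).sub (hcont j)).const_mul _).rexp).measurable.ennreal_ofReal
        rw [lintegral_finsetSum _ fun j _ ↦ (hme j).const_mul _]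
        exact Finset.sum_congr rfl fun j _ ↦ lintegral_const_mul _ (hme j)
    _ ≤ ∑ j ∈ Finset.range m, ENNReal.ofReal (m : ℝ)⁻¹ * ENNReal.ofReal R := by
        gcongr with j
        exact step j
    _ = ENNReal.ofReal R := by
        rw [Finset.sum_const, Finset.card_range, nsmul_eq_mul, ← mul_assoc,
          ← ENNReal.ofReal_natCast, ← ENNReal.ofReal_mul (Nat.cast_nonneg _), mul_inv_cancel₀ hm',
          ENNReal.ofReal_one, one_mul]

-- As `m → ∞` the Gaussian factor stays below `exp (a² π² / 8)`, since `m sin (π / (2m)) ≤ π / 2`.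
-- The other factor tends to `mgf 0 = 1`, because `m (1 - cos (π / (2m)))` is of order `1 / m`.
open ProbabilityTheory Filter Topology in
lemma lintegral_exp_norm_sub_norm_le {E W : Type*} [NormedAddCommGroup E]
    [InnerProductSpace ℝ E] [FiniteDimensional ℝ E] [MeasurableSpace E] [BorelSpace E]
    [NormedAddCommGroup W] [NormedSpace ℝ W] (T : E →L[ℝ] W) (hT : ‖T‖ ≤ 1)
    {a : ℝ} (ha : 0 ≤ a) :
    ∫⁻ p : E × E, ENNReal.ofReal (Real.exp (a * (‖T p.2‖ - ‖T p.1‖)))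
        ∂((stdGaussian E).prod (stdGaussian E))
      ≤ ENNReal.ofReal (Real.exp (a ^ 2 * Real.pi ^ 2 / 8)) := by
  have hmgf : Continuous (mgf (fun x ↦ ‖T x‖) (stdGaussian E)) :=
    continuous_mgf fun t ↦ integrable_exp_mul_norm_map_stdGaussian T t
  have h0 : Tendsto (fun m : ℕ ↦ a * m * (1 - Real.cos (Real.pi / (2 * m)))) atTop (𝓝 0) := by
    have hlim : Tendsto (fun m : ℕ ↦ a * Real.pi ^ 2 / 8 / (m : ℝ)) atTop (𝓝 0) :=
      tendsto_const_div_atTop_nhds_zero_nat _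
    refine squeeze_zero' (Eventually.of_forall fun m ↦ ?_) ?_ hlim
    · have := Real.cos_le_one (Real.pi / (2 * m))
      have : 0 ≤ 1 - Real.cos (Real.pi / (2 * m)) := by linarith
      positivity
    · filter_upwards [eventually_gt_atTop 0] with m hm
      have hm' : (0 : ℝ) < m := by positivity
      have h1 := Real.one_sub_sq_div_two_le_cos (x := Real.pi / (2 * m))
      calc a * m * (1 - Real.cos (Real.pi / (2 * m)))
          ≤ a * m * ((Real.pi / (2 * m)) ^ 2 / 2) := by gcongr; linarith
        _ = _ := by field_simp; ring
  have hlim : Tendsto (fun m : ℕ ↦ ENNReal.ofReal (Real.exp (a ^ 2 * Real.pi ^ 2 / 8) *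
      mgf (fun x ↦ ‖T x‖) (stdGaussian E) (a * m * (1 - Real.cos (Real.pi / (2 * m))))))
      atTop (𝓝 (ENNReal.ofReal (Real.exp (a ^ 2 * Real.pi ^ 2 / 8)))) := by
    have := ((hmgf.tendsto 0).comp h0).const_mul (Real.exp (a ^ 2 * Real.pi ^ 2 / 8))
    rw [mgf_zero, mul_one] at this
    exact ENNReal.tendsto_ofReal this
  refine ge_of_tendsto hlim ?_
  filter_upwards [eventually_gt_atTop 0] with m hm
  refine (lintegral_exp_norm_sub_norm_le_of_steps T hT ha hm).trans ?_
  have hm' : (0 : ℝ) < m := by positivity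
  have hs : Real.sin (Real.pi / (2 * m)) ^ 2 ≤ (Real.pi / (2 * m)) ^ 2 :=
    sq_le_sq.2 Real.abs_sin_le_abs
  have : (a * m) ^ 2 * Real.sin (Real.pi / (2 * m)) ^ 2 / 2 ≤ a ^ 2 * Real.pi ^ 2 / 8 :=
    calc (a * m) ^ 2 * Real.sin (Real.pi / (2 * m)) ^ 2 / 2
        ≤ (a * m) ^ 2 * (Real.pi / (2 * m)) ^ 2 / 2 := by gcongr
      _ = _ := by field_simp; ring
  gcongr
  exact mgf_nonneg

open ProbabilityTheory in
lemma integrable_norm_map_stdGaussian {E W : Type*} [NormedAddCommGroup E]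
    [InnerProductSpace ℝ E] [FiniteDimensional ℝ E] [MeasurableSpace E] [BorelSpace E]
    [NormedAddCommGroup W] [NormedSpace ℝ W] (T : E →L[ℝ] W) :
    Integrable (fun x : E ↦ ‖T x‖) (stdGaussian E) := by
  refine (integrable_exp_mul_norm_map_stdGaussian T 1).mono'
    (Continuous.aestronglyMeasurable (by fun_prop)) (ae_of_all _ fun x ↦ ?_)
  rw [norm_norm, one_mul]
  linarith [Real.add_one_le_exp ‖T x‖]

open ProbabilityTheory in
/-- **Gaussian concentration for seminorms** (Maurey–Pisier): exponential moments. -/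
lemma mgf_norm_map_stdGaussian_le {E W : Type*} [NormedAddCommGroup E]
    [InnerProductSpace ℝ E] [FiniteDimensional ℝ E] [MeasurableSpace E] [BorelSpace E]
    [NormedAddCommGroup W] [NormedSpace ℝ W] (T : E →L[ℝ] W) (hT : ‖T‖ ≤ 1)
    {a : ℝ} (ha : 0 ≤ a) :
    mgf (fun x ↦ ‖T x‖) (stdGaussian E) a ≤
      Real.exp (a * ∫ x, ‖T x‖ ∂(stdGaussian E) + a ^ 2 * Real.pi ^ 2 / 8) := by
  set F : E → ℝ := fun x ↦ ‖T x‖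
  have hexp := integrable_exp_mul_norm_map_stdGaussian T
  have hmeas : ∀ b : ℝ, Measurable fun x : E ↦ ENNReal.ofReal (Real.exp (b * ‖T x‖)) := fun b ↦
    (Continuous.measurable (by fun_prop)).ennreal_ofReal
  have hof : ∀ b : ℝ, ENNReal.ofReal (mgf F (stdGaussian E) b) =
      ∫⁻ x, ENNReal.ofReal (Real.exp (b * ‖T x‖)) ∂(stdGaussian E) := fun b ↦
    ofReal_integral_eq_lintegral_ofReal (hexp b) (ae_of_all _ fun _ ↦ Real.exp_nonneg _)
  -- By independence the product is the exponential moment of `F y - F x` for two independent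
  -- copies; Jensen then bounds the factor at `-a` from below.
  have key : mgf F (stdGaussian E) (-a) * mgf F (stdGaussian E) a ≤
      Real.exp (a ^ 2 * Real.pi ^ 2 / 8) := by
    rw [← ENNReal.ofReal_le_ofReal_iff (Real.exp_nonneg _), ENNReal.ofReal_mul mgf_nonneg, hof,
      hof, ← lintegral_prod_mul (hmeas _).aemeasurable (hmeas _).aemeasurable]
    refine le_trans (le_of_eq (lintegral_congr fun p ↦ ?_)) (lintegral_exp_norm_sub_norm_le T hT ha)
    rw [← ENNReal.ofReal_mul (Real.exp_nonneg _), ← Real.exp_add]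
    congr 2
    ring
  have jensen : Real.exp (-a * ∫ x, F x ∂(stdGaussian E)) ≤ mgf F (stdGaussian E) (-a) := by
    rw [← integral_const_mul]
    exact convexOn_exp.map_integral_le Real.continuous_exp.continuousOn isClosed_univ
      (ae_of_all _ fun _ ↦ Set.mem_univ _) ((integrable_norm_map_stdGaussian T).const_mul _)
      (hexp (-a))
  have h3 := (mul_le_mul_of_nonneg_right jensen mgf_nonneg).trans key
  calc mgf F (stdGaussian E) a
      = Real.exp (a * ∫ x, F x ∂(stdGaussian E)) *
          (Real.exp (-a * ∫ x, F x ∂(stdGaussian E)) * mgf F (stdGaussian E) a) := by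
        rw [← mul_assoc, ← Real.exp_add]
        simp
    _ ≤ Real.exp (a * ∫ x, F x ∂(stdGaussian E)) * Real.exp (a ^ 2 * Real.pi ^ 2 / 8) := by gcongr
    _ = _ := by rw [← Real.exp_add]

open ProbabilityTheory in
/-- **Gaussian concentration for seminorms** (Maurey–Pisier): tail bound. -/
lemma stdGaussian_real_norm_map_ge_le {E W : Type*} [NormedAddCommGroup E]
    [InnerProductSpace ℝ E] [FiniteDimensional ℝ E] [MeasurableSpace E] [BorelSpace E]
    [NormedAddCommGroup W] [NormedSpace ℝ W] (T : E →L[ℝ] W) (hT : ‖T‖ ≤ 1)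
    {M t : ℝ} (hM : ∫ x, ‖T x‖ ∂(stdGaussian E) ≤ M) (ht : M ≤ t) :
    (stdGaussian E).real {x | t ≤ ‖T x‖} ≤ Real.exp (-(2 * (t - M) ^ 2 / Real.pi ^ 2)) := by
  have ha : 0 ≤ 4 * (t - M) / Real.pi ^ 2 := by
    have : 0 ≤ t - M := by linarith
    positivity
  -- The minimizer of the Chernoff exponent `-a (t - M) + a² π² / 8`.
  set a := 4 * (t - M) / Real.pi ^ 2 with hadef
  refine (measure_ge_le_exp_mul_mgf t ha (integrable_exp_mul_norm_map_stdGaussian T a)).trans ?_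
  calc Real.exp (-a * t) * mgf (fun x ↦ ‖T x‖) (stdGaussian E) a
      ≤ Real.exp (-a * t) * Real.exp (a * M + a ^ 2 * Real.pi ^ 2 / 8) := by
        gcongr
        refine (mgf_norm_map_stdGaussian_le T hT ha).trans ?_
        gcongr
    _ = _ := by
        rw [← Real.exp_add, hadef]
        congr 1
        have := Real.pi_ne_zero
        field_simp
        ring

/-! ### Gaussian density, polar coordinates and comparison with the sphere. -/

open ProbabilityTheory in
/-- The density of the standard Gaussian measure with respect to Lebesgue measure. -/
lemma stdGaussian_eq_withDensity (E : Type*) [NormedAddCommGroup E] [InnerProductSpace ℝ E]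
    [FiniteDimensional ℝ E] [MeasurableSpace E] [BorelSpace E] :
    stdGaussian E = (volume : Measure E).withDensity fun x ↦ ENNReal.ofReal
      (((2 * Real.pi) ^ (Module.finrank ℝ E / 2 : ℝ))⁻¹ * Real.exp (-(1 / 2) * ‖x‖ ^ 2)) := by
  set c : ℝ := ((2 * Real.pi) ^ (Module.finrank ℝ E / 2 : ℝ))⁻¹ with hc
  have hpi := Real.pi_pos
  have hc0 : 0 ≤ c := by positivity
  have hmeas : Measurable fun x : E ↦ ENNReal.ofReal (c * Real.exp (-(1 / 2) * ‖x‖ ^ 2)) :=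
    (Continuous.measurable (by fun_prop)).ennreal_ofReal
  have hint : Integrable fun x : E ↦ c * Real.exp (-(1 / 2) * ‖x‖ ^ 2) := by
    refine Integrable.const_mul ?_ c
    have h := (GaussianFourier.integrable_cexp_neg_mul_sq_norm_add (b := 1 / 2) (by norm_num) 0
      (0 : E)).re
    refine h.congr (ae_of_all _ fun x ↦ ?_)
    have : (-(1 / 2 : ℂ) * (‖x‖ : ℂ) ^ 2 + 0 * ((inner ℝ (0 : E) x : ℝ) : ℂ)) =
      ((-(1 / 2) * ‖x‖ ^ 2 : ℝ) : ℂ) := by push_cast; ring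
    simp only
    rw [this, ← Complex.ofReal_exp]
    exact Complex.ofReal_re _
  have : IsFiniteMeasure ((volume : Measure E).withDensity fun x ↦ ENNReal.ofReal
      (c * Real.exp (-(1 / 2) * ‖x‖ ^ 2))) :=
    isFiniteMeasure_withDensity_ofReal hint.2
  refine Measure.ext_of_charFun ?_
  ext t
  rw [charFun_stdGaussian, charFun_apply, integral_withDensity_eq_integral_toReal_smul hmeas
    (ae_of_all _ fun _ ↦ ENNReal.ofReal_lt_top)]
  have h := GaussianFourier.integral_cexp_neg_mul_sq_norm_add (b := 1 / 2) (by norm_num) Complex.I t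
  have hcC : (c : ℂ) * ((Real.pi : ℂ) / (1 / 2)) ^ (Module.finrank ℝ E / 2 : ℂ) = 1 := by
    have h2 : ((Real.pi : ℂ) / (1 / 2)) = ((2 * Real.pi : ℝ) : ℂ) := by push_cast; ring
    have h3 : (Module.finrank ℝ E / 2 : ℂ) = ((Module.finrank ℝ E / 2 : ℝ) : ℂ) := by push_cast; rfl
    rw [h2, h3, ← Complex.ofReal_cpow (by positivity), ← Complex.ofReal_mul, hc,
      inv_mul_cancel₀ (by positivity), Complex.ofReal_one]
  calc Complex.exp (-‖t‖ ^ 2 / 2)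
      = (c : ℂ) * (((Real.pi : ℂ) / (1 / 2)) ^ (Module.finrank ℝ E / 2 : ℂ) *
          Complex.exp (Complex.I ^ 2 * ‖t‖ ^ 2 / (4 * (1 / 2)))) := by
        rw [← mul_assoc, hcC, one_mul, Complex.I_sq]
        congr 1
        ring
    _ = _ := by
        rw [← h, ← integral_const_mul]
        refine integral_congr_ae (ae_of_all _ fun x ↦ ?_)
        simp only
        rw [ENNReal.toReal_ofReal (by positivity), Complex.real_smul, Complex.ofReal_mul, mul_assoc,
          Complex.ofReal_exp, ← Complex.exp_add, real_inner_comm]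
        push_cast
        congr 2
        ring

/-- Polar coordinates for the Lebesgue integral of a nonnegative function. -/
lemma lintegral_eq_lintegral_toSphere_prod {E : Type*} [NormedAddCommGroup E] [NormedSpace ℝ E]
    [FiniteDimensional ℝ E] [MeasurableSpace E] [BorelSpace E] [Nontrivial E] (μ : Measure E)
    [μ.IsAddHaarMeasure] (f : E → ℝ≥0∞) :
    ∫⁻ x, f x ∂μ = ∫⁻ p : Metric.sphere (0 : E) 1 × Set.Ioi (0 : ℝ),
      f (p.2.1 • p.1.1) ∂(μ.toSphere.prod (Measure.volumeIoiPow (Module.finrank ℝ E - 1))) := by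
  rw [← μ.measurePreserving_homeomorphUnitSphereProd.lintegral_comp_emb
    (homeomorphUnitSphereProd E).measurableEmbedding]
  have h1 : ∀ x : ({0}ᶜ : Set E), ((homeomorphUnitSphereProd E x).2.1 •
      (homeomorphUnitSphereProd E x).1.1 : E) = x := fun x ↦ by
    have := congrArg Subtype.val ((homeomorphUnitSphereProd E).symm_apply_apply x)
    simpa only [homeomorphUnitSphereProd_symm_apply_coe] using this
  simp only [h1]
  rw [lintegral_subtype_comap (measurableSet_singleton _).compl,
    restrict_compl_singleton]

open ProbabilityTheory in
/-- Direction and length of a standard Gaussian vector are independent, the direction being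
uniform on the sphere: comparison of the tails of a seminorm. -/
lemma uniformSphere_mul_stdGaussian_le {E W : Type*} [NormedAddCommGroup E]
    [InnerProductSpace ℝ E] [FiniteDimensional ℝ E] [MeasurableSpace E] [BorelSpace E]
    [Nontrivial E] [NormedAddCommGroup W] [NormedSpace ℝ W] (T : E →L[ℝ] W)
    {t s : ℝ} (ht : 0 ≤ t) :
    uniformSphere E {u | t ≤ ‖T u‖} * stdGaussian E {x | s ≤ ‖x‖} ≤
      stdGaussian E {x | t * s ≤ ‖T x‖} := by
  set c : ℝ := ((2 * Real.pi) ^ (Module.finrank ℝ E / 2 : ℝ))⁻¹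
  let h : ℝ → ℝ≥0∞ := fun r ↦ ENNReal.ofReal (c * Real.exp (-(1 / 2) * r ^ 2))
  let k : Set.Ioi (0 : ℝ) → ℝ≥0∞ := fun r ↦ {r : Set.Ioi (0 : ℝ) | s ≤ r}.indicator (fun r ↦ h r) r
  have hγ : ∀ S : Set E, MeasurableSet S →
      stdGaussian E S = ∫⁻ x, S.indicator (fun x ↦ h ‖x‖) x := fun S hS ↦ by
    rw [stdGaussian_eq_withDensity, withDensity_apply _ hS, lintegral_indicator hS]
  set σ := (volume : Measure E).toSphere
  set ν := Measure.volumeIoiPow (Module.finrank ℝ E - 1)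
  let A : Set (Metric.sphere (0 : E) 1) := {u | t ≤ ‖T u‖}
  have hA : MeasurableSet A := (isClosed_le (by fun_prop) (by fun_prop)).measurableSet
  have hk : Measurable k := Measurable.indicator
    ((Continuous.measurable (by fun_prop)).ennreal_ofReal)
    (isClosed_le (by fun_prop) (by fun_prop)).measurableSet
  have hnorm : ∀ p : Metric.sphere (0 : E) 1 × Set.Ioi (0 : ℝ), ‖p.2.1 • p.1.1‖ = p.2.1 :=
    fun p ↦ by
      have h1 : ‖(p.1.1 : E)‖ = 1 := by simp
      rw [norm_smul, h1, mul_one, Real.norm_of_nonneg (le_of_lt p.2.2)]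
  have polar_univ : stdGaussian E {x | s ≤ ‖x‖} = σ Set.univ * ∫⁻ r, k r ∂ν := by
    rw [hγ _ (isClosed_le (by fun_prop) (by fun_prop)).measurableSet,
      lintegral_eq_lintegral_toSphere_prod, ← lintegral_one,
      ← lintegral_prod_mul aemeasurable_const hk.aemeasurable]
    refine lintegral_congr fun p ↦ ?_
    simp only [Set.indicator, Set.mem_ofPred_eq, hnorm, k, one_mul]
  -- By homogeneity the second condition depends only on the direction and the first only on the
  -- length, so the integral factors.
  have polar_A : stdGaussian E {x | s ≤ ‖x‖ ∧ t * ‖x‖ ≤ ‖T x‖} = σ A * ∫⁻ r, k r ∂ν := by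
    have hS : MeasurableSet {x : E | s ≤ ‖x‖ ∧ t * ‖x‖ ≤ ‖T x‖} :=
      ((isClosed_le (f := fun _ : E ↦ s) (g := fun x ↦ ‖x‖) (by fun_prop) (by fun_prop)).inter
        (isClosed_le (f := fun x : E ↦ t * ‖x‖) (g := fun x ↦ ‖T x‖)
          (by fun_prop) (by fun_prop))).measurableSet
    rw [hγ _ hS, lintegral_eq_lintegral_toSphere_prod, ← lintegral_indicator_one hA,
      ← lintegral_prod_mul ((measurable_one.indicator hA).aemeasurable) hk.aemeasurable]
    refine lintegral_congr fun p ↦ ?_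
    have hp : (0 : ℝ) < p.2.1 := p.2.2
    have h2 : t * p.2.1 ≤ ‖T (p.2.1 • p.1.1)‖ ↔ p.1 ∈ A := by
      rw [map_smul, norm_smul, Real.norm_of_nonneg hp.le, mul_comm, mul_le_mul_iff_right₀ hp]
      rfl
    simp only [Set.indicator, Set.mem_ofPred_eq, hnorm, k, h2]
    by_cases h3 : p.1 ∈ A <;> simp [h3]
  calc uniformSphere E A * stdGaussian E {x | s ≤ ‖x‖}
      = ((σ Set.univ)⁻¹ * σ Set.univ) * (σ A * ∫⁻ r, k r ∂ν) := by
        rw [polar_univ, uniformSphere, Measure.smul_apply, smul_eq_mul]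
        ring
    _ = stdGaussian E {x | s ≤ ‖x‖ ∧ t * ‖x‖ ≤ ‖T x‖} := by
        rw [ENNReal.inv_mul_cancel (by simpa using Measure.toSphere_ne_zero _) (measure_ne_top _ _),
          one_mul, polar_A]
    _ ≤ stdGaussian E {x | t * s ≤ ‖T x‖} := by
        refine measure_mono fun x hx ↦ ?_
        exact (mul_le_mul_of_nonneg_left hx.1 ht).trans hx.2

/-! ### The length of a Gaussian vector. -/

open ProbabilityTheory in
lemma integral_exp_neg_mul_sq_norm_stdGaussian (E : Type*) [NormedAddCommGroup E]
    [InnerProductSpace ℝ E] [FiniteDimensional ℝ E] [MeasurableSpace E] [BorelSpace E]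
    {b : ℝ} (hb : 0 ≤ b) :
    ∫ x, Real.exp (-b * ‖x‖ ^ 2) ∂(stdGaussian E) =
      ((1 + 2 * b) ^ (Module.finrank ℝ E / 2 : ℝ))⁻¹ := by
  have hpi := Real.pi_pos
  rw [stdGaussian_eq_withDensity, integral_withDensity_eq_integral_toReal_smul
    (Continuous.measurable (by fun_prop)).ennreal_ofReal
    (ae_of_all _ fun _ ↦ ENNReal.ofReal_lt_top)]
  calc _ = ∫ x : E, ((2 * Real.pi) ^ (Module.finrank ℝ E / 2 : ℝ))⁻¹ *
        Real.exp (-(1 / 2 + b) * ‖x‖ ^ 2) := by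
        refine integral_congr_ae (ae_of_all _ fun x ↦ ?_)
        simp only
        rw [ENNReal.toReal_ofReal (by positivity), smul_eq_mul, mul_assoc, ← Real.exp_add]
        congr 2
        ring
    _ = _ := by
        rw [integral_const_mul, GaussianFourier.integral_rexp_neg_mul_sq_norm (by positivity),
          ← Real.inv_rpow (by positivity), ← Real.inv_rpow (by positivity),
          ← Real.mul_rpow (by positivity) (by positivity)]
        congr 1
        field_simp

open ProbabilityTheory in
/-- A standard Gaussian vector in high dimension `N` has length at least `0.85 √N` with probability
at least `1 / 4`. -/
lemma one_fourth_le_stdGaussian_norm_ge (E : Type*) [NormedAddCommGroup E]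
    [InnerProductSpace ℝ E] [FiniteDimensional ℝ E] [MeasurableSpace E] [BorelSpace E]
    (hN : 256 ≤ Module.finrank ℝ E) :
    1 / 4 ≤ (stdGaussian E).real {x | 17 / 20 * √(Module.finrank ℝ E) ≤ ‖x‖} := by
  set N : ℝ := ((Module.finrank ℝ E : ℕ) : ℝ) with hNdef
  have hN' : (256 : ℝ) ≤ N := by rw [hNdef]; exact_mod_cast hN
  have hS : MeasurableSet {x : E | 17 / 20 * √N ≤ ‖x‖} :=
    (isClosed_le (by fun_prop) (by fun_prop)).measurableSet
  have hcompl := probReal_compl_eq_one_sub (μ := stdGaussian E) hS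
  have hint : Integrable (fun x : E ↦ Real.exp (-1 * ((1 / 5) * ‖x‖ ^ 2))) (stdGaussian E) := by
    refine (integrable_const (1 : ℝ)).mono' (Continuous.aestronglyMeasurable (by fun_prop))
      (ae_of_all _ fun x ↦ ?_)
    rw [Real.norm_of_nonneg (Real.exp_nonneg _), Real.exp_le_one_iff]
    have : 0 ≤ ‖x‖ ^ 2 := by positivity
    linarith
  -- Chernoff bound for the lower tail. With `7/5 ≥ exp (3/10)` the exponent is `(0.1445 - 0.15) N =
  -- -(11/2000) N`, which is below `-1` for `N ≥ 256`.
  have hle := measure_le_le_exp_mul_mgf (μ := stdGaussian E) (X := fun x ↦ (1 / 5) * ‖x‖ ^ 2)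
    (1 / 5 * (17 / 20) ^ 2 * N) (t := -1) (by norm_num) hint
  have hmgf : mgf (fun x : E ↦ (1 / 5) * ‖x‖ ^ 2) (stdGaussian E) (-1) =
      ((7 / 5 : ℝ) ^ (N / 2))⁻¹ := by
    have := integral_exp_neg_mul_sq_norm_stdGaussian E (b := 1 / 5) (by norm_num)
    norm_num [mgf] at this ⊢
    simpa only [neg_mul, hNdef, one_div] using this
  have h75 : Real.exp (3 / 10) ≤ 7 / 5 := by
    have h1 := Real.one_sub_le_exp_neg (3 / 20)
    have h2 : Real.exp (3 / 20) * Real.exp (-(3 / 20)) = 1 := by rw [← Real.exp_add]; simp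
    have h3 : Real.exp (3 / 20) ≤ 20 / 17 := by
      nlinarith [Real.exp_pos (3 / 20)]
    have h4 : Real.exp (3 / 10) = Real.exp (3 / 20) ^ 2 := by
      rw [← Real.exp_nat_mul]; norm_num
    rw [h4]
    calc Real.exp (3 / 20) ^ 2 ≤ (20 / 17) ^ 2 := by gcongr
      _ ≤ 7 / 5 := by norm_num
  have hpow : ((7 / 5 : ℝ) ^ (N / 2))⁻¹ ≤ Real.exp (-(3 / 20) * N) := by
    have : Real.exp (3 / 20 * N) ≤ (7 / 5 : ℝ) ^ (N / 2) := by
      calc Real.exp (3 / 20 * N) = Real.exp (3 / 10) ^ (N / 2) := by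
            rw [← Real.exp_mul]; congr 1; ring
        _ ≤ _ := Real.rpow_le_rpow (Real.exp_nonneg _) h75 (by positivity)
    rw [neg_mul, Real.exp_neg]
    exact inv_anti₀ (Real.exp_pos _) this
  have hsub : {x : E | 17 / 20 * √N ≤ ‖x‖}ᶜ ⊆
      {x | (1 / 5) * ‖x‖ ^ 2 ≤ 1 / 5 * (17 / 20) ^ 2 * N} := by
    intro x hx
    simp only [Set.mem_compl_iff, Set.mem_ofPred_eq, not_le] at hx ⊢
    have h1 : ‖x‖ ^ 2 ≤ (17 / 20 * √N) ^ 2 := by gcongr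
    rw [mul_pow, Real.sq_sqrt (by positivity)] at h1
    linarith
  have h34 : (stdGaussian E).real {x : E | 17 / 20 * √N ≤ ‖x‖}ᶜ ≤ 3 / 4 := by
    refine (measureReal_mono hsub).trans (hle.trans ?_)
    rw [hmgf]
    calc _ ≤ Real.exp (-(-1) * (1 / 5 * (17 / 20) ^ 2 * N)) * Real.exp (-(3 / 20) * N) := by gcongr
      _ = Real.exp (-(11 / 2000) * N) := by rw [← Real.exp_add]; congr 1; ring
      _ ≤ Real.exp (-1) := by gcongr; linarith
      _ ≤ 3 / 4 := by
        have := Real.exp_neg_one_lt_d9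
        linarith
  rw [hcompl] at h34
  linarith

/-! ### Comparison of the `L^q` norms. -/

lemma lqNorm_ofReal_eq {n : ℕ} {q : ℝ} (hq : 0 < q) (x : EuclideanSpace ℝ (Fin n)) :
    lqNorm (ENNReal.ofReal q) x = (∑ i, |x i| ^ q) ^ (1 / q) := by
  have h : (ENNReal.ofReal q).toReal = q := ENNReal.toReal_ofReal hq.le
  rw [lqNorm, PiLp.norm_eq_sum (by rw [h]; exact hq), h]
  rfl

lemma lqNorm_ofReal_rpow {n : ℕ} {q : ℝ} (hq : 0 < q) (x : EuclideanSpace ℝ (Fin n)) :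
    lqNorm (ENNReal.ofReal q) x ^ q = ∑ i, |x i| ^ q := by
  rw [lqNorm_ofReal_eq hq, ← Real.rpow_mul (Finset.sum_nonneg fun _ _ ↦ by positivity),
    one_div_mul_cancel hq.ne', Real.rpow_one]

/-- Each `|x i|` is at most `‖x‖`, so `q - 2` of the `q` powers can be taken out of the sum. This
serves both to give the Lipschitz constant 1 and to empty the event above level 1. -/
lemma lqNorm_ofReal_le_norm {n : ℕ} {q : ℝ} (hq : 2 ≤ q) (x : EuclideanSpace ℝ (Fin n)) :
    lqNorm (ENNReal.ofReal q) x ≤ ‖x‖ := by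
  have hq0 : 0 < q := by linarith
  rw [lqNorm_ofReal_eq hq0, one_div, Real.rpow_inv_le_iff_of_pos
    (Finset.sum_nonneg fun _ _ ↦ by positivity) (norm_nonneg _) hq0]
  have hsplit : ∀ y : ℝ, 0 ≤ y → y ^ q = y ^ 2 * y ^ (q - 2) := fun y hy ↦ by
    rw [← Real.rpow_natCast, ← Real.rpow_add_of_nonneg hy (by norm_num) (by linarith)]
    norm_num
  calc ∑ i, |x i| ^ q ≤ ∑ i, |x i| ^ 2 * ‖x‖ ^ (q - 2) := by
        refine Finset.sum_le_sum fun i _ ↦ ?_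
        rw [hsplit _ (abs_nonneg _)]
        exact mul_le_mul_of_nonneg_left (Real.rpow_le_rpow (abs_nonneg _)
          (PiLp.norm_apply_le x i) (by linarith)) (by positivity)
    _ = ‖x‖ ^ q := by
        rw [← Finset.sum_mul, hsplit _ (norm_nonneg x), EuclideanSpace.real_norm_sq_eq]
        simp only [sq_abs]

lemma lqNorm_top_le_lqNorm_ofReal {n : ℕ} {q : ℝ} (hq : 0 < q) (x : EuclideanSpace ℝ (Fin n)) :
    lqNorm ∞ x ≤ lqNorm (ENNReal.ofReal q) x := by
  have h0 : 0 ≤ lqNorm (ENNReal.ofReal q) x := by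
    rw [lqNorm_ofReal_eq hq]; positivity
  rw [lqNorm, PiLp.norm_eq_ciSup]
  refine Real.iSup_le (fun i ↦ ?_) h0
  rw [lqNorm_ofReal_eq hq, one_div, Real.le_rpow_inv_iff_of_pos (norm_nonneg _)
    (Finset.sum_nonneg fun _ _ ↦ by positivity) hq]
  exact Finset.single_le_sum (f := fun i ↦ |x i| ^ q) (fun _ _ ↦ by positivity) (Finset.mem_univ i)

/-- The `L^q` norm on a subspace of Euclidean space is the norm of the image under a contraction. -/
lemma exists_contraction_norm_eq_lqNorm {n : ℕ} (V : Submodule ℝ (EuclideanSpace ℝ (Fin n)))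
    {q : ℝ} (hq : 2 ≤ q) [Fact (1 ≤ ENNReal.ofReal q)] :
    ∃ T : V →L[ℝ] PiLp (ENNReal.ofReal q) (fun _ : Fin n ↦ ℝ), ‖T‖ ≤ 1 ∧
      ∀ x : V, ‖T x‖ = lqNorm (ENNReal.ofReal q) (x : EuclideanSpace ℝ (Fin n)) := by
  let f : V →ₗ[ℝ] PiLp (ENNReal.ofReal q) (fun _ : Fin n ↦ ℝ) :=
    { toFun := fun x ↦ WithLp.toLp _ (WithLp.ofLp (x : EuclideanSpace ℝ (Fin n)))
      map_add' := fun _ _ ↦ rfl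
      map_smul' := fun _ _ ↦ rfl }
  refine ⟨f.mkContinuous 1 fun x ↦ ?_, f.mkContinuous_norm_le zero_le_one _, fun x ↦ rfl⟩
  rw [one_mul]
  exact lqNorm_ofReal_le_norm hq _

/-! ### The mean of the `L^q` norm of a Gaussian vector. -/

open ProbabilityTheory in
/-- Absolute moments of a linear form of norm at most one under the standard Gaussian measure. -/
lemma integral_abs_strongDual_rpow_stdGaussian_le {E : Type*} [NormedAddCommGroup E]
    [InnerProductSpace ℝ E] [FiniteDimensional ℝ E] [MeasurableSpace E] [BorelSpace E]
    {q : ℝ} (hq : 2 ≤ q) (L : StrongDual ℝ E) (hL : ‖L‖ ≤ 1) :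
    Integrable (fun x ↦ |L x| ^ q) (stdGaussian E) ∧
      ∫ x, |L x| ^ q ∂(stdGaussian E) ≤ ‖L‖ ^ 2 * √q ^ q := by
  have hq0 : 0 < q := by linarith
  have hsq : 0 < √q := Real.sqrt_pos.2 hq0
  -- The `q`-th power of `|y| ≤ √q exp (|y| / √q - 1)`. Integrated, the exponentials contribute at
  -- most `2 exp (-q/2) ≤ 2/e < 1`.
  have key : ∀ y : ℝ, |y| ^ q ≤
      √q ^ q * Real.exp (-q) * (Real.exp (√q * y) + Real.exp (-√q * y)) := by
    intro y
    have h1 : |y| ≤ √q * Real.exp (|y| / √q - 1) := by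
      have := Real.add_one_le_exp (|y| / √q - 1)
      calc |y| = √q * (|y| / √q - 1 + 1) := by field_simp; ring
        _ ≤ _ := by gcongr
    have h2 : Real.exp (√q * |y|) ≤ Real.exp (√q * y) + Real.exp (-√q * y) := by
      rcases abs_cases y with ⟨h, _⟩ | ⟨h, _⟩ <;> rw [h]
      · exact le_add_of_nonneg_right (Real.exp_nonneg _)
      · rw [mul_neg, ← neg_mul]
        exact le_add_of_nonneg_left (Real.exp_nonneg _)
    calc |y| ^ q ≤ (√q * Real.exp (|y| / √q - 1)) ^ q :=
          Real.rpow_le_rpow (abs_nonneg _) h1 hq0.le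
      _ = √q ^ q * Real.exp (-q) * Real.exp (√q * |y|) := by
          rw [Real.mul_rpow hsq.le (Real.exp_nonneg _), ← Real.exp_mul, mul_assoc, ← Real.exp_add]
          congr 2
          symm
          calc -q + √q * |y| = -q + q / √q * |y| := by rw [Real.div_sqrt]
            _ = _ := by ring
      _ ≤ _ := by gcongr
  have hexp : ∀ (M : StrongDual ℝ E) (t : ℝ),
      Integrable (fun x ↦ Real.exp (t * M x)) (stdGaussian E) := fun M t ↦ by
    have h := mgf_strongDual_stdGaussian M t
    by_contra hc
    -- A non-integrable function would have integral 0, against the positive value of the moment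
    -- generating function.
    rw [mgf, integral_undef hc] at h
    exact (Real.exp_pos _).ne h
  have hunit : ∀ M : StrongDual ℝ E, ‖M‖ ≤ 1 → Integrable (fun x ↦ |M x| ^ q) (stdGaussian E) ∧
      ∫ x, |M x| ^ q ∂(stdGaussian E) ≤ √q ^ q := by
    intro M hM
    have hb : Integrable (fun x ↦ √q ^ q * Real.exp (-q) *
        (Real.exp (√q * M x) + Real.exp (-√q * M x))) (stdGaussian E) :=
      ((hexp M _).add (hexp M _)).const_mul _
    have hi : Integrable (fun x ↦ |M x| ^ q) (stdGaussian E) := by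
      refine hb.mono' (Continuous.aestronglyMeasurable ?_) (ae_of_all _ fun x ↦ ?_)
      · exact (by fun_prop : Continuous fun x ↦ |M x|).rpow_const fun _ ↦ Or.inr hq0.le
      · rw [Real.norm_of_nonneg (by positivity)]
        exact key (M x)
    refine ⟨hi, (integral_mono hi hb fun x ↦ key (M x)).trans ?_⟩
    have h1 : ∀ t, t ^ 2 = q → ∫ x, Real.exp (t * M x) ∂(stdGaussian E) ≤ Real.exp (q / 2) := by
      intro t ht
      have := mgf_strongDual_stdGaussian M t
      rw [mgf] at this
      rw [this, ht, Real.exp_le_exp]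
      have : ‖M‖ ^ 2 ≤ 1 := pow_le_one₀ (norm_nonneg _) hM
      nlinarith
    rw [integral_const_mul, integral_add (hexp M _) (hexp M _), mul_assoc]
    refine mul_le_of_le_one_right (by positivity) ?_
    calc _ ≤ Real.exp (-q) * (Real.exp (q / 2) + Real.exp (q / 2)) := by
          gcongr
          · exact h1 _ (Real.sq_sqrt hq0.le)
          · exact h1 _ (by rw [neg_sq, Real.sq_sqrt hq0.le])
      _ = 2 * Real.exp (-(q / 2)) := by
          rw [← two_mul, mul_left_comm, ← Real.exp_add]
          congr 2
          ring
      _ ≤ 2 * Real.exp (-1) := by gcongr; linarith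
      _ ≤ 1 := by
          have := Real.exp_neg_one_lt_d9
          linarith
  refine ⟨(hunit L hL).1, ?_⟩
  rcases eq_or_ne L 0 with rfl | hL0
  · simp [Real.zero_rpow hq0.ne']
  · have hn : 0 < ‖L‖ := norm_pos_iff.2 hL0
    have h1 : ‖‖L‖⁻¹ • L‖ ≤ 1 := by
      rw [norm_smul, norm_inv, norm_norm, inv_mul_cancel₀ hn.ne']
    have h2 : ∀ x, |L x| ^ q = ‖L‖ ^ q * |(‖L‖⁻¹ • L) x| ^ q := fun x ↦ by
      rw [← Real.mul_rpow (norm_nonneg _) (abs_nonneg _)]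
      congr 1
      rw [smul_apply, smul_eq_mul, abs_mul, abs_of_pos (inv_pos.2 hn),
        mul_inv_cancel_left₀ hn.ne']
    simp_rw [h2]
    rw [integral_const_mul]
    -- Lowering the exponent to 2 makes the bounds summable over coordinates, with total `N`
    -- whatever the position of the subspace.
    have h3 : ‖L‖ ^ q ≤ ‖L‖ ^ 2 := by
      rw [← Real.rpow_natCast]
      exact Real.rpow_le_rpow_of_exponent_ge hn hL (by exact_mod_cast hq)
    exact mul_le_mul h3 (hunit _ h1).2 (integral_nonneg fun _ ↦ by positivity) (by positivity)

/-- The squared norms of the coordinate forms restricted to a subspace sum up to its dimension. -/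
lemma sum_sq_norm_proj_comp_subtypeL {n : ℕ} (V : Submodule ℝ (EuclideanSpace ℝ (Fin n))) :
    ∑ i, ‖(EuclideanSpace.proj (𝕜 := ℝ) i : StrongDual ℝ (EuclideanSpace ℝ (Fin n))).comp
      V.subtypeL‖ ^ 2 = Module.finrank ℝ V := by
  let b := stdOrthonormalBasis ℝ V
  simp_rw [b.norm_dual]
  rw [Finset.sum_comm]
  have : ∀ k, ∑ i, ((EuclideanSpace.proj (𝕜 := ℝ) i :
      StrongDual ℝ (EuclideanSpace ℝ (Fin n))).comp V.subtypeL) (b k) ^ 2 = 1 := fun k ↦ by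
    have h1 : ‖(b k : EuclideanSpace ℝ (Fin n))‖ = 1 := b.orthonormal.1 k
    have h2 := EuclideanSpace.real_norm_sq_eq (b k : EuclideanSpace ℝ (Fin n))
    rw [h1] at h2
    simpa using h2.symm
  rw [Finset.sum_congr rfl fun k _ ↦ this k]
  simp

open ProbabilityTheory in
/-- The expected `L^q` norm of a standard Gaussian vector of a subspace of dimension `N` is at most
`√q N ^ (1 / q)`. -/
lemma integral_lqNorm_stdGaussian_le {n : ℕ} (V : Submodule ℝ (EuclideanSpace ℝ (Fin n)))
    [Nontrivial V] {q : ℝ} (hq : 2 ≤ q) :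
    ∫ x : V, lqNorm (ENNReal.ofReal q) (x : EuclideanSpace ℝ (Fin n)) ∂(stdGaussian V) ≤
      √q * (Module.finrank ℝ V : ℝ) ^ (1 / q) := by
  have hq0 : 0 < q := by linarith
  have hsq : 0 < √q := Real.sqrt_pos.2 hq0
  have hN : (0 : ℝ) < Module.finrank ℝ V := by exact_mod_cast Module.finrank_pos
  set B := √q * (Module.finrank ℝ V : ℝ) ^ (1 / q) with hB
  have hB0 : 0 < B := by positivity
  have hBq : B ^ q = √q ^ q * Module.finrank ℝ V := by
    rw [hB, Real.mul_rpow hsq.le (by positivity), ← Real.rpow_mul hN.le,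
      one_div_mul_cancel hq0.ne', Real.rpow_one]
  let L : Fin n → StrongDual ℝ V := fun i ↦
    (EuclideanSpace.proj (𝕜 := ℝ) i : StrongDual ℝ (EuclideanSpace ℝ (Fin n))).comp V.subtypeL
  have hL : ∀ i, ‖L i‖ ≤ 1 := fun i ↦ by
    refine ContinuousLinearMap.opNorm_le_bound _ zero_le_one fun x ↦ ?_
    rw [one_mul]
    exact PiLp.norm_apply_le (x : EuclideanSpace ℝ (Fin n)) i
  have hmom := fun i ↦ integral_abs_strongDual_rpow_stdGaussian_le hq (L i) (hL i)
  have hpow : ∀ x : V, lqNorm (ENNReal.ofReal q) (x : EuclideanSpace ℝ (Fin n)) ^ q =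
      ∑ i, |L i x| ^ q := fun x ↦ lqNorm_ofReal_rpow hq0 _
  have hnn : ∀ x : V, 0 ≤ lqNorm (ENNReal.ofReal q) (x : EuclideanSpace ℝ (Fin n)) := fun x ↦ by
    rw [lqNorm_ofReal_eq hq0]; positivity
  have hint : Integrable (fun x : V ↦ ∑ i, |L i x| ^ q) (stdGaussian V) :=
    integrable_finsetSum _ fun i _ ↦ (hmom i).1
  have hsum : ∫ x : V, ∑ i, |L i x| ^ q ∂(stdGaussian V) ≤ B ^ q := by
    rw [integral_finsetSum _ fun i _ ↦ (hmom i).1, hBq, mul_comm,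
      ← sum_sq_norm_proj_comp_subtypeL V, Finset.sum_mul]
    exact Finset.sum_le_sum fun i _ ↦ (hmom i).2
  -- Bernoulli's inequality `(y/B)^q ≥ 1 + q (y/B - 1)`, a tangent line at `y = B`. It replaces
  -- Jensen: a `q`-th moment of at most `B ^ q` gives a mean of at most `B`.
  have hpt : ∀ x : V, lqNorm (ENNReal.ofReal q) (x : EuclideanSpace ℝ (Fin n)) ≤
      B * (1 - 1 / q + (∑ i, |L i x| ^ q) / (q * B ^ q)) := fun x ↦ by
    set y := lqNorm (ENNReal.ofReal q) (x : EuclideanSpace ℝ (Fin n))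
    have hy : 0 ≤ y / B := div_nonneg (hnn x) hB0.le
    have h := one_add_mul_self_le_rpow_one_add (s := y / B - 1) (by linarith) (p := q)
      (by linarith)
    rw [add_sub_cancel, Real.div_rpow (hnn x) hB0.le, hpow x] at h
    have h2 : y / B ≤ 1 - 1 / q + (∑ i, |L i x| ^ q) / (q * B ^ q) := by
      rw [← mul_le_mul_iff_right₀ hq0]
      have h3 : q * (1 - 1 / q + (∑ i, |L i x| ^ q) / (q * B ^ q)) =
        q - 1 + (∑ i, |L i x| ^ q) / B ^ q := by
          have : B ^ q ≠ 0 := by positivity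
          field_simp
      rw [h3]
      linarith
    rwa [div_le_iff₀' hB0] at h2
  have hintR : Integrable (fun x : V ↦ B * (1 - 1 / q + (∑ i, |L i x| ^ q) / (q * B ^ q)))
      (stdGaussian V) := ((integrable_const _).add (hint.div_const _)).const_mul _
  calc ∫ x : V, lqNorm (ENNReal.ofReal q) (x : EuclideanSpace ℝ (Fin n)) ∂(stdGaussian V)
      ≤ ∫ x : V, B * (1 - 1 / q + (∑ i, |L i x| ^ q) / (q * B ^ q)) ∂(stdGaussian V) :=
        integral_mono_of_nonneg (ae_of_all _ hnn) hintR (ae_of_all _ hpt)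
    _ = B * (1 - 1 / q + (∫ x : V, ∑ i, |L i x| ^ q ∂(stdGaussian V)) / (q * B ^ q)) := by
        rw [integral_const_mul, integral_add (integrable_const _) (hint.div_const _),
          integral_div]
        simp
    _ ≤ B * (1 - 1 / q + B ^ q / (q * B ^ q)) := by gcongr
    _ = B := by
        have : B ^ q ≠ 0 := by positivity
        field_simp
        ring

/-! ### Tail bounds on the sphere of a subspace, and the theorem. -/

lemma finrank_spectralSpan {n : ℕ} (ψ : OrthonormalBasis (Fin n) ℝ (EuclideanSpace ℝ (Fin n)))
    (lam : Fin n → ℝ) (I : Set ℝ) :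
    Module.finrank ℝ (spectralSpan ψ lam I) = eigenCount lam I := by
  classical
  have hli : LinearIndepOn ℝ id (ψ '' {k | lam k ∈ I}) :=
    (ψ.orthonormal.linearIndependent.linearIndepOn _).id_image
  rw [spectralSpan, eigenCount, finrank_span_set_eq_card hli, ← Set.ncard_eq_toFinset_card',
    Set.ncard_image_of_injective _ ψ.orthonormal.linearIndependent.injective]

lemma uniformSphere_le_one (E : Type*) [NormedAddCommGroup E] [InnerProductSpace ℝ E]
    [FiniteDimensional ℝ E] [MeasurableSpace E] [BorelSpace E]
    (S : Set (Metric.sphere (0 : E) 1)) : uniformSphere E S ≤ 1 := by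
  refine (measure_mono (Set.subset_univ S)).trans ?_
  rw [uniformSphere, Measure.smul_apply, smul_eq_mul]
  exact ENNReal.inv_mul_le_one _

open ProbabilityTheory in
/-- Tail bound for the `L^q` norm of a uniform unit vector of a subspace of Euclidean space. -/
lemma uniformSphere_lqNorm_ge_le {n : ℕ} (V : Submodule ℝ (EuclideanSpace ℝ (Fin n)))
    [Nontrivial V] {q : ℝ} (hq : 2 ≤ q) {a : ℝ} (ha : 16 ≤ a) :
    uniformSphere V {u | a * √q * (Module.finrank ℝ V : ℝ) ^ (1 / q - 1 / 2) ≤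
        lqNorm (ENNReal.ofReal q) ((u : V) : EuclideanSpace ℝ (Fin n))} ≤
      ENNReal.ofReal (4 * Real.exp (-(1 / 8) * a ^ 2 * q * (Module.finrank ℝ V : ℝ) ^ (2 / q))) := by
  have hq0 : 0 < q := by linarith
  set N : ℝ := ((Module.finrank ℝ V : ℕ) : ℝ) with hNdef
  have hN1 : 1 ≤ N := by rw [hNdef]; exact_mod_cast Module.finrank_pos
  have hN0 : 0 < N := by linarith
  set t := a * √q * N ^ (1 / q - 1 / 2) with ht
  set M := √q * N ^ (1 / q) with hM
  have hsN : N ^ (1 / 2 : ℝ) = √N := (Real.sqrt_eq_rpow N).symm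
  have htM : t * √N = a * M := by
    rw [ht, hM, Real.rpow_sub hN0, hsN]
    field_simp
  have hsN0 : 0 < √N := Real.sqrt_pos.2 hN0
  have hMge : 1 ≤ M := by
    have h1 : 1 ≤ √q := Real.one_le_sqrt.2 (by linarith)
    have h2 : 1 ≤ N ^ (1 / q) := Real.one_le_rpow hN1 (by positivity)
    nlinarith
  have hMsq : M ^ 2 = q * N ^ (2 / q) := by
    rw [hM, mul_pow, Real.sq_sqrt hq0.le, ← Real.rpow_natCast, ← Real.rpow_mul hN0.le]
    congr 2
    push_cast
    ring
  -- A unit vector has `L^q` norm at most 1, so only `t ≤ 1` matters; then `√N ≥ t √N = a M ≥ 16`.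
  rcases lt_or_ge 1 t with ht1 | ht1
  · have hempty : {u : Metric.sphere (0 : V) 1 |
        t ≤ lqNorm (ENNReal.ofReal q) ((u : V) : EuclideanSpace ℝ (Fin n))} = ∅ := by
      refine Set.eq_empty_of_forall_notMem fun u hu ↦ ?_
      have h1 : ‖((u : V) : EuclideanSpace ℝ (Fin n))‖ = 1 :=
        mem_sphere_zero_iff_norm.1 u.2
      have h2 := lqNorm_ofReal_le_norm hq ((u : V) : EuclideanSpace ℝ (Fin n))
      have h3 : t ≤ _ := hu
      linarith
    rw [hempty, measure_empty]
    exact zero_le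
  · have hN256 : 256 ≤ Module.finrank ℝ V := by
      have h1 : 16 ≤ √N := by nlinarith
      have h2 : (256 : ℝ) ≤ N := by
        have := Real.sq_sqrt hN0.le
        nlinarith
      rw [hNdef] at h2
      exact_mod_cast h2
    have : Fact (1 ≤ ENNReal.ofReal q) := ⟨by
      rw [ENNReal.one_le_ofReal]; linarith⟩
    obtain ⟨T, hT, hTx⟩ := exists_contraction_norm_eq_lqNorm V hq
    have ht0 : 0 ≤ t := by positivity
    have hcmp := uniformSphere_mul_stdGaussian_le T (t := t) (s := 17 / 20 * √N) ht0
    have hquarter := one_fourth_le_stdGaussian_norm_ge V hN256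
    rw [← hNdef] at hquarter
    have hmean : ∫ x, ‖T x‖ ∂(stdGaussian V) ≤ M := by
      simp_rw [hTx]
      exact integral_lqNorm_stdGaussian_le V hq
    have hts : t * (17 / 20 * √N) = 17 / 20 * a * M := by rw [mul_left_comm, htM]; ring
    have htail := stdGaussian_real_norm_map_ge_le T hT hmean
      (t := t * (17 / 20 * √N)) (by rw [hts]; nlinarith)
    have hexp : -(2 * (t * (17 / 20 * √N) - M) ^ 2 / Real.pi ^ 2) ≤
        -(1 / 8) * a ^ 2 * q * N ^ (2 / q) := by
      have hpi := Real.pi_pos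
      have hpi2 := Real.pi_lt_d4
      -- This reads `(3.4 - π) a ≥ 4`, which holds from about `a = 15.5` on, hence for `a ≥ 16`.
      have h1 : Real.pi * a ≤ 4 * (17 / 20 * a - 1) := by nlinarith
      have h2 : (Real.pi * a) ^ 2 ≤ (4 * (17 / 20 * a - 1)) ^ 2 := by gcongr
      have h3 : 1 / 8 * a ^ 2 ≤ 2 * (17 / 20 * a - 1) ^ 2 / Real.pi ^ 2 := by
        rw [le_div_iff₀ (by positivity)]
        nlinarith
      have h4 := mul_le_mul_of_nonneg_right h3 (sq_nonneg M)
      rw [hts]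
      have h5 : 2 * (17 / 20 * a * M - M) ^ 2 / Real.pi ^ 2 =
        2 * (17 / 20 * a - 1) ^ 2 / Real.pi ^ 2 * M ^ 2 := by ring
      rw [h5, mul_assoc, ← hMsq]
      linarith
    have hset : {u : Metric.sphere (0 : V) 1 |
        t ≤ lqNorm (ENNReal.ofReal q) ((u : V) : EuclideanSpace ℝ (Fin n))} =
        {u : Metric.sphere (0 : V) 1 | t ≤ ‖T u‖} := by
      simp_rw [hTx]
    rw [hset]
    have hσ : uniformSphere V {u : Metric.sphere (0 : V) 1 | t ≤ ‖T u‖} ≠ ∞ :=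
      ((uniformSphere_le_one V _).trans_lt ENNReal.one_lt_top).ne
    have hreal := ENNReal.toReal_mono (measure_ne_top _ _) hcmp
    rw [ENNReal.toReal_mul] at hreal
    rw [ENNReal.le_ofReal_iff_toReal_le hσ (by positivity)]
    have hchain := hreal.trans (htail.trans (Real.exp_le_exp.2 hexp))
    have hmul := mul_le_mul_of_nonneg_left hquarter (ENNReal.toReal_nonneg
      (a := uniformSphere V {u : Metric.sphere (0 : V) 1 | t ≤ ‖T u‖}))
    have := hmul.trans hchain
    linarith

/-- Tail bound for the maximum norm of a uniform unit vector of a subspace of Euclidean space. -/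
lemma uniformSphere_lqNorm_top_ge_le {n : ℕ} (V : Submodule ℝ (EuclideanSpace ℝ (Fin n)))
    [Nontrivial V] {a : ℝ} (ha : 16 ≤ a) :
    uniformSphere V {u | a * Real.exp 1 * (Real.log (Module.finrank ℝ V) /
          (Module.finrank ℝ V : ℝ)) ^ (1 / 2 : ℝ) ≤
        lqNorm ∞ ((u : V) : EuclideanSpace ℝ (Fin n))} ≤
      ENNReal.ofReal (4 * (Module.finrank ℝ V : ℝ) ^ (-(1 / 8) * (a * Real.exp 1) ^ 2)) := by
  set N : ℝ := ((Module.finrank ℝ V : ℕ) : ℝ) with hNdef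
  have hN1' : 1 ≤ Module.finrank ℝ V := Module.finrank_pos
  have hN1 : 1 ≤ N := by rw [hNdef]; exact_mod_cast hN1'
  have hN0 : 0 < N := by linarith
  rcases le_or_gt 2 (Real.log N) with hlog | hlog
  -- The choice `q = log N` gives `N^(1/q) = e`, the source of the factor `e` in `C'`.
  · have hq0 : 0 < Real.log N := by linarith
    have hmain := uniformSphere_lqNorm_ge_le V hlog ha
    rw [← hNdef] at hmain
    have hpow1 : N ^ (1 / Real.log N) = Real.exp 1 := by
      rw [Real.rpow_def_of_pos hN0, mul_one_div_cancel hq0.ne']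
    have hpow2 : N ^ (2 / Real.log N) = Real.exp 1 ^ 2 := by
      rw [Real.rpow_def_of_pos hN0, mul_div_cancel₀ _ hq0.ne', ← Real.exp_nat_mul]
      norm_num
    have hthr : a * Real.exp 1 * (Real.log N / N) ^ (1 / 2 : ℝ) =
        a * √(Real.log N) * N ^ (1 / Real.log N - 1 / 2) := by
      rw [Real.rpow_sub hN0, hpow1, Real.div_rpow hq0.le hN0.le, ← Real.sqrt_eq_rpow]
      ring
    have hbound : N ^ (-(1 / 8) * (a * Real.exp 1) ^ 2) =
        Real.exp (-(1 / 8) * a ^ 2 * Real.log N * N ^ (2 / Real.log N)) := by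
      rw [Real.rpow_def_of_pos hN0, hpow2]
      congr 1
      ring
    rw [hthr, hbound]
    refine (measure_mono fun u hu ↦ ?_).trans hmain
    exact le_trans (Set.mem_ofPred.1 hu) (lqNorm_top_le_lqNorm_ofReal hq0 _)
  · rcases hN1'.eq_or_lt with h1 | h2
    -- For `N = 1` the right-hand side is 4, so the bound is trivial.
    · refine (uniformSphere_le_one V _).trans ?_
      rw [ENNReal.one_le_ofReal, hNdef, ← h1]
      norm_num
    · have h2' : (2 : ℝ) ≤ N := by rw [hNdef]; exact_mod_cast h2
      have he : (2 : ℝ) < Real.exp 1 := by linarith [Real.exp_one_gt_d9]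
      have hN2 : N < Real.exp 1 ^ 2 := by
        rw [← Real.exp_nat_mul, ← Real.log_lt_iff_lt_exp hN0]
        simpa using hlog
      have hlog2 : 1 / 2 ≤ Real.log N :=
        (by linarith [Real.log_two_gt_d9] : 1 / 2 ≤ Real.log 2).trans
          (Real.log_le_log two_pos h2')
      -- For `2 ≤ N < e²` one has `log N / N ≥ 1 / (4 e²)`, so the threshold is at least 8 and no
      -- unit vector reaches it.
      have hlarge : 1 < a * Real.exp 1 * (Real.log N / N) ^ (1 / 2 : ℝ) := by
        have h3 : (1 / (2 * Real.exp 1)) ≤ (Real.log N / N) ^ (1 / 2 : ℝ) := by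
          rw [← Real.sqrt_eq_rpow]
          refine Real.le_sqrt_of_sq_le ?_
          rw [div_pow, mul_pow, div_le_div_iff₀ (by positivity) hN0]
          nlinarith
        calc (1 : ℝ) < 16 * Real.exp 1 * (1 / (2 * Real.exp 1)) := by field_simp; norm_num
          _ ≤ _ := by gcongr
      have hempty : {u : Metric.sphere (0 : V) 1 |
          a * Real.exp 1 * (Real.log N / N) ^ (1 / 2 : ℝ) ≤
            lqNorm ∞ ((u : V) : EuclideanSpace ℝ (Fin n))} = ∅ := by
        refine Set.eq_empty_of_forall_notMem fun u hu ↦ ?_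
        have h1 : ‖((u : V) : EuclideanSpace ℝ (Fin n))‖ = 1 :=
        mem_sphere_zero_iff_norm.1 u.2
        have h2 := lqNorm_ofReal_le_norm le_rfl ((u : V) : EuclideanSpace ℝ (Fin n))
        have h3 := lqNorm_top_le_lqNorm_ofReal two_pos ((u : V) : EuclideanSpace ℝ (Fin n))
        have h4 := Set.mem_ofPred.1 hu
        linarith
      rw [hempty, measure_empty]
      exact zero_le

theorem theorem1p6 :
    ∃ C : ℝ, 0 < C ∧
      ∀ (n : ℕ) (H : Matrix (Fin n) (Fin n) ℝ), H.IsSymm →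
      ∀ (ψ : OrthonormalBasis (Fin n) ℝ (EuclideanSpace ℝ (Fin n))) (lam : Fin n → ℝ),
        IsEigenbasis H ψ lam →
      ∀ I : Set ℝ, 1 ≤ eigenCount lam I →
        (∀ q : ℝ, 2 ≤ q → ∀ Λ : ℝ, 1 ≤ Λ →
          uniformSphere (spectralSpan ψ lam I)
              {u | C * Λ * √q * (eigenCount lam I : ℝ) ^ (1 / q - 1 / 2)
                    ≤ lqNorm (ENNReal.ofReal q) ((u : spectralSpan ψ lam I) : EuclideanSpace ℝ (Fin n))}
            ≤ ENNReal.ofReal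
                (4 * Real.exp (-(1 / 8) * C ^ 2 * Λ ^ 2 * q * (eigenCount lam I : ℝ) ^ (2 / q)))) ∧
        (∀ Λ : ℝ, 1 ≤ Λ →
          uniformSphere (spectralSpan ψ lam I)
              {u | (C * Real.exp 1) * Λ *
                      (Real.log (eigenCount lam I) / (eigenCount lam I : ℝ)) ^ (1 / 2 : ℝ)
                    ≤ lqNorm ∞ ((u : spectralSpan ψ lam I) : EuclideanSpace ℝ (Fin n))}
            ≤ ENNReal.ofReal
                (4 * (eigenCount lam I : ℝ) ^ (-(1 / 8) * (C * Real.exp 1) ^ 2 * Λ ^ 2))) := by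
  -- The factor `Λ ≥ 1` is absorbed by taking `a = 16 Λ` in the subspace bounds.
  refine ⟨16, by norm_num, fun n H _ ψ lam _ I hI ↦ ?_⟩
  rw [← finrank_spectralSpan ψ lam I] at hI ⊢
  have : Nontrivial (spectralSpan ψ lam I) := Module.finrank_pos_iff.1 hI
  refine ⟨fun q hq Λ hΛ ↦ ?_, fun Λ hΛ ↦ ?_⟩
  · have := uniformSphere_lqNorm_ge_le (spectralSpan ψ lam I) hq (a := 16 * Λ) (by linarith)
    simpa only [mul_pow, ← mul_assoc] using this
  · have := uniformSphere_lqNorm_top_ge_le (spectralSpan ψ lam I) (a := 16 * Λ) (by linarith)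
    have e1 : (16 * Real.exp 1) * Λ = 16 * Λ * Real.exp 1 := by ring
    have e2 : -(1 / 8) * (16 * Real.exp 1) ^ 2 * Λ ^ 2 =
      -(1 / 8) * (16 * Λ * Real.exp 1) ^ 2 := by ring
    rw [e1, e2]
    exact this
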